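/- All graphs are finite and simple, and may have no vertices. Let $X$ be an apex-forest with at least two vertices, that is, a graph that becomes acyclic after deleting at most one vertex. Let $G$ be a graph that is $X$-minor-free: there is no family $(B_x \mid x\in V(X))$ of pairwise disjoint subsets of $V(G)$, each inducing a non-empty connected subgraph of $G$, such that for every edge $xy$ of $X$ there is an edge of $G$ between $B_x$ and $B_y$. Then $$\operatorname{lpw}(G)\le 2|V(X)|-3 .$$ Here the layered pathwidth $\operatorname{lpw}(G)$ is the minimum, over all path decompositions $(W_i\mid 1\le i\le m)$ of $G$ and all layerings $(L_j\mid j\ge 0)$ of $G$, of $\max_{i,j}|W_i\cap L_j|$. A path decomposition of $G$ is a sequence $W_1,\dots,W_m$ of subsets of $V(G)$ with $m\ge 1$ such that every edge of $G$ has both ends in some $W_i$, and for every vertex $v$ the set $\{i : v\in W_i\}$ is a non-empty set of consecutive integers. A layering of $G$ is a sequence $(L_j\mid j\ge 0)$ of pairwise disjoint (possibly empty) subsets of $V(G)$ with union $V(G)$ such that for every edge $uv$ of $G$ there is $j\ge 0$ with $u,v\in L_j\cup L_{j+1}$. -/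

import Mathlib

namespace SimpleGraph

/-- A model of `H` in `G`: pairwise disjoint branch sets, each inducing a (non-empty) connected
subgraph of `G`, with an edge of `G` between the branch sets of any two adjacent vertices of `H`.
(`SimpleGraph.Connected` includes non-emptiness.) -/
structure MinorModel {W V : Type*} (H : SimpleGraph W) (G : SimpleGraph V) where
  branch : W → Set V
  disjoint : ∀ x y : W, x ≠ y → Disjoint (branch x) (branch y)
  connected : ∀ x : W, (G.induce (branch x)).Connected
  adj : ∀ x y : W, H.Adj x y → ∃ u ∈ branch x, ∃ v ∈ branch y, G.Adj u v

/-- `H` is a minor of `G`. -/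
def IsMinor {W V : Type*} (H : SimpleGraph W) (G : SimpleGraph V) : Prop :=
  Nonempty (MinorModel H G)

/-- `G` is an apex-forest: it becomes acyclic after deleting at most one vertex. -/
def IsApexForest {V : Type*} (G : SimpleGraph V) : Prop :=
  ∃ s : Set V, s.Subsingleton ∧ (G.induce sᶜ).IsAcyclic

/-- A path decomposition of `G`, indexed by a path on `length ≥ 1` vertices: every vertex and every
edge lies in a bag, and the bags containing a given vertex are consecutive. -/
structure PathDecomposition {V : Type*} (G : SimpleGraph V) where
  length : ℕ
  length_pos : 0 < length
  bag : Fin length → Set V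
  edge_mem : ∀ u v : V, G.Adj u v → ∃ i, u ∈ bag i ∧ v ∈ bag i
  vertex_mem : ∀ v : V, ∃ i, v ∈ bag i
  consecutive : ∀ (v : V) (i j k : Fin length), i ≤ j → j ≤ k → v ∈ bag i → v ∈ bag k → v ∈ bag j

/-- A layering of `G`: a sequence of pairwise disjoint (possibly empty) sets covering the vertices,
such that both ends of each edge lie in the union of two consecutive sets. -/
structure Layering {V : Type*} (G : SimpleGraph V) where
  layer : ℕ → Set V
  disjoint : ∀ i j : ℕ, i ≠ j → Disjoint (layer i) (layer j)
  cover : ⋃ i, layer i = Set.univ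
  edge_mem : ∀ u v : V, G.Adj u v →
    ∃ i, u ∈ layer i ∪ layer (i + 1) ∧ v ∈ layer i ∪ layer (i + 1)

/-- The width of a path decomposition together with a layering: the largest size of the
intersection of a bag and a layer. -/
noncomputable def layeredWidth {V : Type*} {G : SimpleGraph V}
    (B : PathDecomposition G) (L : Layering G) : ℕ∞ :=
  ⨆ (i : Fin B.length) (j : ℕ), (B.bag i ∩ L.layer j).encard

/-- The layered pathwidth of `G`: the least width of a pair of a path decomposition and a layering.
As `ℕ∞` is well-ordered and the family of pairs is non-empty, the infimum is a minimum. -/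
noncomputable def layeredPathwidth {V : Type*} (G : SimpleGraph V) : ℕ∞ :=
  ⨅ (B : PathDecomposition G) (L : Layering G), layeredWidth B L

end SimpleGraph

/-! Write `X` as a vertex `a` plus a forest `F = X - a`, so that `2|F| - 1 = 2|V(X)| - 3 = N`. If a
connected set `A` outside `C` contains all outside neighbours of `C` (a hub), it can serve as the
branch set of `a`. Hence `G[C]` has no model of `F` all of whose branch sets meet the boundary `S`
of `C`.

The core, `exists_isFocusedDecomposition_of_no_rooted_model`, is a rooted form of the theorem that
excluding a forest bounds pathwidth: without an `S`-rooted model of `F` there are a path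
decomposition and a set `H` containing `S` such that each bag has at most `N` vertices of `H` and
every vertex outside `H` lies in one bag only. A model of `F` is grown leaf by leaf in maximal
exposed sets; Menger's theorem carries its branch sets to each new boundary and at last to `S`.

Now let `H` be layer 0. If `H` is chosen minimal, each remainder `U j \ H` has a hub again, so
recursion decomposes it with its neighbours of `H` in its own layer 0. Shifting these layers up by
one and refining each bag decomposes `G[C]`. Distinct remainders share no vertex and no edge, so the
widths do not add up. The whole graph has no hub to start from; there `H` is a single vertex, which
is then a hub of the rest. -/

namespace SimpleGraph

/-! ### Connected sets and leaves of forests. -/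

section Connectivity

variable {V : Type*} {G : SimpleGraph V}

/-- The spanning subgraph of `G` that keeps the edges with both ends in `C`. -/
def restrict (G : SimpleGraph V) (C : Set V) : SimpleGraph V where
  Adj u v := G.Adj u v ∧ u ∈ C ∧ v ∈ C
  symm := ⟨fun _ _ h => ⟨h.1.symm, h.2.2, h.2.1⟩⟩
  loopless := ⟨fun _ h => G.loopless.irrefl _ h.1⟩

theorem restrict_le (G : SimpleGraph V) (C : Set V) : G.restrict C ≤ G := fun _ _ h => h.1

theorem connected_induce_mono {G₁ G₂ : SimpleGraph V} (h : G₁ ≤ G₂) {P : Set V}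
    (hP : (G₁.induce P).Connected) : (G₂.induce P).Connected :=
  hP.mono fun _ _ hab => h hab

theorem connected_induce_singleton (v : V) : (G.induce {v}).Connected := by
  rw [connected_iff_exists_forall_reachable]
  refine ⟨⟨v, rfl⟩, ?_⟩
  rintro ⟨w, rfl⟩
  exact Reachable.refl _

/-- A connected set that meets `T` and cannot leave `T` along an edge is contained in `T`. -/
theorem subset_of_connected_induce {P T : Set V} (hP : (G.induce P).Connected)
    (hne : (P ∩ T).Nonempty)
    (hT : ∀ u ∈ P, u ∈ T → ∀ w ∈ P, G.Adj u w → w ∈ T) : P ⊆ T := by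
  obtain ⟨v, hvP, hvT⟩ := hne
  intro w hw
  by_contra hwT
  obtain ⟨p⟩ := hP.preconnected ⟨v, hvP⟩ ⟨w, hw⟩
  obtain ⟨d, -, h1, h2⟩ := p.exists_boundary_dart {z | z.1 ∈ T} hvT hwT
  exact h2 (hT _ d.fst.2 h1 _ d.snd.2 d.adj)

theorem subset_of_connected_induce_restrict {P C : Set V}
    (hP : ((G.restrict C).induce P).Connected) (hne : (P ∩ C).Nonempty) : P ⊆ C :=
  subset_of_connected_induce hP hne fun _ _ _ _ _ h => h.2.2

/-- A finite nonempty part of a forest has a vertex with at most one neighbour in that part. -/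
theorem IsAcyclic.exists_leaf {W : Type*} {F : SimpleGraph W} (hF : F.IsAcyclic) {A : Finset W}
    (hA : A.Nonempty) :
    ∃ t ∈ A, ∀ u ∈ A, ∀ v ∈ A, F.Adj t u → F.Adj t v → u = v := by
  classical
  have hac : (F.induce (A : Set W)).IsAcyclic := hF.induce _
  obtain ⟨a, ha⟩ := hA
  have : Nonempty (A : Set W) := ⟨⟨a, ha⟩⟩
  -- A longest path starts at a leaf: another neighbour of its start would close a cycle or lengthen
  -- the path.
  obtain ⟨u, v, p, hp, hmax⟩ :=
    Walk.exists_isPath_forall_isPath_length_le_length (F.induce (A : Set W))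
  have key : ∀ w, (F.induce (A : Set W)).Adj u w → w = p.snd := by
    intro w hw
    refine hac.eq_snd_of_adj_start hp hw ?_
    by_contra hns
    have h1 := hmax _ _ (Walk.cons hw.symm p) (hp.cons hns)
    simp at h1
  refine ⟨u, u.2, fun w hw z hz hwa hza => ?_⟩
  have h1 := key ⟨w, hw⟩ hwa
  have h2 := key ⟨z, hz⟩ hza
  exact congrArg Subtype.val (h1.trans h2.symm)

end Connectivity

/-! ### Menger's theorem for disjoint connected sets. -/

section Menger

variable {V : Type*}

/-- There are `k` pairwise disjoint connected sets that each meet both `A` and `B`. -/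
def Linked (G : SimpleGraph V) (A B : Set V) (k : ℕ) : Prop :=
  ∃ (I : Set V) (P : V → Set V), I.ncard = k ∧ I.PairwiseDisjoint P ∧
    ∀ i ∈ I, (G.induce (P i)).Connected ∧ (P i ∩ A).Nonempty ∧ (P i ∩ B).Nonempty

theorem Linked.symm {G : SimpleGraph V} {A B : Set V} {k : ℕ} (h : G.Linked A B k) :
    G.Linked B A k := by
  obtain ⟨I, P, h1, h2, h3⟩ := h
  exact ⟨I, P, h1, h2, fun i hi => ⟨(h3 i hi).1, (h3 i hi).2.2, (h3 i hi).2.1⟩⟩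

theorem Linked.mono {G₁ G₂ : SimpleGraph V} (h : G₁ ≤ G₂) {A B : Set V} {k : ℕ}
    (hL : G₁.Linked A B k) : G₂.Linked A B k := by
  obtain ⟨I, P, h1, h2, h3⟩ := hL
  exact ⟨I, P, h1, h2, fun i hi => ⟨connected_induce_mono h (h3 i hi).1, (h3 i hi).2⟩⟩

/-- If `A` has exactly `k` vertices then the `k` linking sets can be indexed by `A`. -/
theorem Linked.exists_indexed [Finite V] {G : SimpleGraph V} {A B : Set V} {k : ℕ}
    (h : G.Linked A B k) (hA : A.ncard ≤ k) :
    ∃ P : V → Set V, A.PairwiseDisjoint P ∧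
      ∀ a ∈ A, a ∈ P a ∧ (G.induce (P a)).Connected ∧ (P a ∩ B).Nonempty := by
  classical
  obtain ⟨I, P, h1, h2, h3⟩ := h
  choose! e he using fun i hi => (h3 i hi).2.1
  have hinj : Set.InjOn e I := by
    intro i hi j hj hij
    by_contra hne
    refine Set.disjoint_left.1 (h2 hi hj hne) (he i hi).1 ?_
    rw [hij]
    exact (he j hj).1
  have himg : e '' I = A := by
    refine Set.eq_of_subset_of_ncard_le ?_ ?_ (Set.toFinite _)
    · rintro _ ⟨i, hi, rfl⟩
      exact (he i hi).2
    · rw [hinj.ncard_image, h1]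
      exact hA
  have hsurj : ∀ a ∈ A, ∃ i ∈ I, e i = a := fun a ha => by rwa [← himg] at ha
  choose! r hr using hsurj
  refine ⟨fun a => P (r a), ?_, fun a ha => ⟨?_, (h3 _ (hr a ha).1).1, (h3 _ (hr a ha).1).2.2⟩⟩
  · intro a ha b hb hab
    refine h2 (hr a ha).1 (hr b hb).1 fun h => hab ?_
    rw [← (hr a ha).2, ← (hr b hb).2, h]
  · have := (he _ (hr a ha).1).1
    rwa [(hr a ha).2] at this

/-- The vertices of `Z` through which one can leave `Z` or enter `B`. -/
def exitSet (G : SimpleGraph V) (B Z : Set V) : Set V :=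
  {v | v ∈ Z ∧ (v ∈ B ∨ ∃ w, w ∉ Z ∧ G.Adj v w)}

/-- Menger's theorem, for linkages by disjoint connected sets. -/
theorem linked_of_forall_le_ncard_exitSet [Finite V] (G : SimpleGraph V) (A B : Set V) (k : ℕ)
    (h : ∀ Z, A ⊆ Z → k ≤ (G.exitSet B Z).ncard) : G.Linked A B k := by
  classical
  induction G using WellFoundedLT.induction generalizing A B with
  | ind G ih =>
  by_cases hedge : ∃ x y, G.Adj x y
  swap
  · push Not at hedge
    have h0 := h A subset_rfl
    obtain ⟨I, hI, hIk⟩ := Set.exists_subset_card_eq h0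
    refine ⟨I, fun v => {v}, hIk, ?_, ?_⟩
    · intro a _ b _ hab
      exact Set.disjoint_singleton.2 hab
    · intro i hi
      obtain ⟨h1, h2 | ⟨w, -, h2⟩⟩ := hI hi
      · exact ⟨connected_induce_singleton i, ⟨i, rfl, h1⟩, ⟨i, rfl, h2⟩⟩
      · exact absurd h2 (hedge _ _)
  -- Delete an edge. If some exit set `S` of a set `Z` drops below `k`, the edge leaves `Z`, say
  -- from `x` to `y`, and `S + x` and `S + y` have exactly `k` vertices. A linkage from `A` to `S +
  -- x` inside `Z` and one from `S + y` to `B` inside `Zᶜ ∪ S` are glued at `S` and along `xy`.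
  obtain ⟨x₀, y₀, hxy₀⟩ := hedge
  set G' := G.deleteEdges {s(x₀, y₀)} with hG'
  have hG'adj : ∀ u v, G'.Adj u v ↔ G.Adj u v ∧ s(u, v) ≠ s(x₀, y₀) := by
    intro u v
    simp [hG', deleteEdges_adj]
  have hlt : G' < G := by
    refine lt_of_le_of_ne (deleteEdges_le _) fun he => ?_
    have := (hG'adj x₀ y₀).1 (he ▸ hxy₀)
    exact this.2 rfl
  by_cases hdel : ∀ Z, A ⊆ Z → k ≤ (G'.exitSet B Z).ncard
  · exact (ih G' hlt A B hdel).mono hlt.le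
  push Not at hdel
  obtain ⟨Z, hAZ, hZ⟩ := hdel
  obtain ⟨x, y, hxy, hx, hy, hG'xy⟩ : ∃ x y, G.Adj x y ∧ x ∈ Z ∧ y ∉ Z ∧
      ∀ u v, u ∈ Z → v ∉ Z → G.Adj u v → G'.Adj u v ∨ (u = x ∧ v = y) := by
    by_contra hcon
    have : G.exitSet B Z ⊆ G'.exitSet B Z := by
      rintro v ⟨hv, hv' | ⟨w, hw, hvw⟩⟩
      · exact ⟨hv, Or.inl hv'⟩
      refine ⟨hv, Or.inr ⟨w, hw, (hG'adj _ _).2 ⟨hvw, fun heq => hcon ⟨v, w, hvw, hv, hw, ?_⟩⟩⟩⟩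
      intro a b ha hb hab
      by_cases hs : s(a, b) = s(x₀, y₀)
      · rw [← heq] at hs
        rcases Sym2.eq_iff.1 hs with h1 | h1
        · exact Or.inr h1
        · exact absurd hv (h1.2 ▸ hb)
      · exact Or.inl ((hG'adj _ _).2 ⟨hab, hs⟩)
    have := Set.ncard_le_ncard this (Set.toFinite _)
    have := h Z hAZ
    omega
  set S := G'.exitSet B Z with hS
  have hSZ : S ⊆ Z := fun v hv => hv.1
  have hexit : G.exitSet B Z ⊆ insert x S := by
    rintro v ⟨hv, hv' | ⟨w, hw, hvw⟩⟩
    · exact Or.inr ⟨hv, Or.inl hv'⟩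
    · rcases hG'xy v w hv hw hvw with h1 | h1
      · exact Or.inr ⟨hv, Or.inr ⟨w, hw, h1⟩⟩
      · exact Or.inl h1.1
  have hxS : x ∉ S := by
    intro hxS
    rw [Set.insert_eq_of_mem hxS] at hexit
    have := Set.ncard_le_ncard hexit (Set.toFinite _)
    have := h Z hAZ
    omega
  have hyS : y ∉ S := fun hyS => hy (hSZ hyS)
  have hcardx : (insert x S).ncard ≤ k := by
    rw [Set.ncard_insert_of_notMem hxS]; omega
  have hcardy : (insert y S).ncard ≤ k := by
    rw [Set.ncard_insert_of_notMem hyS]; omega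
  have hlt1 : G.restrict Z < G := by
    refine lt_of_le_of_ne (restrict_le _ _) fun he => ?_
    have h1 : (G.restrict Z).Adj x y := by rw [he]; exact hxy
    exact hy h1.2.2
  have hlt2 : G.restrict (Zᶜ ∪ S) < G := by
    refine lt_of_le_of_ne (restrict_le _ _) fun he => ?_
    have h1 : (G.restrict (Zᶜ ∪ S)).Adj x y := by rw [he]; exact hxy
    rcases h1.2.1 with h2 | h2
    · exact h2 hx
    · exact hxS h2
  -- The exit set of `T` in this part contains that of `T ∩ Z` in `G`; for the other part `Z ∪ T`
  -- plays this role.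
  have hL1 : (G.restrict Z).Linked A (insert x S) k := by
    refine ih _ hlt1 _ _ fun T hT => (h (T ∩ Z) (Set.subset_inter hT hAZ)).trans
      (Set.ncard_le_ncard ?_ (Set.toFinite _))
    rintro v ⟨⟨hvT, hvZ⟩, hv | ⟨w, hw, hvw⟩⟩
    · exact ⟨hvT, Or.inl (hexit ⟨hvZ, Or.inl hv⟩)⟩
    · by_cases hwZ : w ∈ Z
      · exact ⟨hvT, Or.inr ⟨w, fun hwT => hw ⟨hwT, hwZ⟩, hvw, hvZ, hwZ⟩⟩
      · exact ⟨hvT, Or.inl (hexit ⟨hvZ, Or.inr ⟨w, hwZ, hvw⟩⟩)⟩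
  have hL2 : (G.restrict (Zᶜ ∪ S)).Linked (insert y S) B k := by
    refine ih _ hlt2 _ _ fun T hT => (h (Z ∪ T) (hAZ.trans Set.subset_union_left)).trans
      (Set.ncard_le_ncard ?_ (Set.toFinite _))
    have hST : S ⊆ T := (Set.subset_insert _ _).trans hT
    have hyT : y ∈ T := hT (Set.mem_insert _ _)
    rintro v ⟨hvZT, hv | ⟨w, hw, hvw⟩⟩
    · by_cases hvZ : v ∈ Z
      · exact ⟨hST ⟨hvZ, Or.inl hv⟩, Or.inl hv⟩
      · exact ⟨hvZT.resolve_left hvZ, Or.inl hv⟩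
    · have hwZ : w ∉ Z := fun h1 => hw (Or.inl h1)
      have hwT : w ∉ T := fun h1 => hw (Or.inr h1)
      by_cases hvZ : v ∈ Z
      · have hvS : v ∈ S := by
          rcases hG'xy v w hvZ hwZ hvw with h1 | h1
          · exact ⟨hvZ, Or.inr ⟨w, hwZ, h1⟩⟩
          · exact absurd hyT (h1.2 ▸ hwT)
        exact ⟨hST hvS, Or.inr ⟨w, hwT, hvw, Or.inr hvS, Or.inl hwZ⟩⟩
      · exact ⟨hvZT.resolve_left hvZ, Or.inr ⟨w, hwT, hvw, Or.inl hvZ, Or.inl hwZ⟩⟩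
  obtain ⟨P, hPd, hP⟩ := hL1.symm.exists_indexed hcardx
  obtain ⟨R, hRd, hR⟩ := hL2.exists_indexed hcardy
  have hcardx' : (insert x S).ncard = k :=
    le_antisymm hcardx ((h Z hAZ).trans (Set.ncard_le_ncard hexit (Set.toFinite _)))
  have hPZ : ∀ b ∈ insert x S, P b ⊆ Z := fun b hb =>
    subset_of_connected_induce_restrict (hP b hb).2.1
      ⟨b, (hP b hb).1, (Set.insert_subset hx hSZ) hb⟩
  have hRZ : ∀ b ∈ insert y S, R b ⊆ Zᶜ ∪ S := fun b hb =>
    subset_of_connected_induce_restrict (hR b hb).2.1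
      ⟨b, (hR b hb).1, hb.elim (fun h1 => Or.inl (h1 ▸ hy)) Or.inr⟩
  let σ : V → V := fun b => if b = x then y else b
  have hσ : ∀ b ∈ insert x S, σ b ∈ insert y S := by
    intro b hb
    by_cases hbx : b = x
    · simp [σ, hbx]
    · simp only [σ, if_neg hbx]
      exact Or.inr (hb.resolve_left hbx)
  have hσinj : ∀ a ∈ insert x S, ∀ b ∈ insert x S, a ≠ b → σ a ≠ σ b := by
    intro a ha b hb hab
    by_cases hax : a = x <;> by_cases hbx : b = x
    · exact absurd (hax.trans hbx.symm) hab
    · simp only [σ, if_pos hax, if_neg hbx]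
      rintro rfl
      exact hyS (hb.resolve_left hbx)
    · simp only [σ, if_neg hax, if_pos hbx]
      rintro rfl
      exact hyS (ha.resolve_left hax)
    · simpa only [σ, if_neg hax, if_neg hbx] using hab
  have hcross : ∀ a ∈ insert x S, ∀ b ∈ insert x S, a ≠ b → Disjoint (P a) (R (σ b)) := by
    intro a ha b hb hab
    rw [Set.disjoint_left]
    intro v hva hvb
    have hvS : v ∈ S := (hRZ _ (hσ b hb) hvb).resolve_left fun h1 => h1 (hPZ a ha hva)
    have hvx : v ≠ x := fun h1 => hxS (h1 ▸ hvS)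
    have h1 : v = a := by
      by_contra hne
      exact Set.disjoint_left.1 (hPd (Or.inr hvS) ha hne) (hP v (Or.inr hvS)).1 hva
    have h2 : v = σ b := by
      by_contra hne
      exact Set.disjoint_left.1 (hRd (Or.inr hvS) (hσ b hb) hne) (hR v (Or.inr hvS)).1 hvb
    refine hσinj a ha b hb hab ?_
    rw [← h2, ← h1]
    simp only [σ, if_neg hvx]
  refine ⟨insert x S, fun b => P b ∪ R (σ b), hcardx', ?_, ?_⟩
  · intro a ha b hb hab
    refine Set.disjoint_union_left.2 ⟨Set.disjoint_union_right.2
      ⟨hPd ha hb hab, hcross a ha b hb hab⟩, Set.disjoint_union_right.2 ⟨(hcross b hb a ha hab.symm).symm,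
        hRd (hσ a ha) (hσ b hb) (hσinj a ha b hb hab)⟩⟩
  · intro b hb
    have hPc := connected_induce_mono (restrict_le _ _) (hP b hb).2.1
    have hRc := connected_induce_mono (restrict_le _ _) (hR _ (hσ b hb)).2.1
    refine ⟨?_, (hP b hb).2.2.mono (Set.inter_subset_inter_left _ Set.subset_union_left),
      (hR _ (hσ b hb)).2.2.mono (Set.inter_subset_inter_left _ Set.subset_union_right)⟩
    change (G.induce (P b ∪ R (σ b))).Connected
    by_cases hbx : b = x
    · have h1 : σ b = y := by simp [σ, hbx]
      rw [h1] at hRc ⊢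
      refine connected_induce_union hPc.preconnected hRc.preconnected (hP b hb).1
        (h1 ▸ (hR _ (hσ b hb)).1) ?_
      rw [hbx]
      exact hxy
    · have h1 : σ b = b := by simp [σ, hbx]
      rw [h1] at hRc ⊢
      exact induce_union_connected hPc.preconnected hRc.preconnected
        ⟨b, (hP b hb).1, by simpa only [h1] using (hR _ (hσ b hb)).1⟩

/-- The vertices of `X` that have a neighbour outside `X`. -/
def innerBoundary (G : SimpleGraph V) (X : Set V) : Set V :=
  {v | v ∈ X ∧ ∃ w, w ∉ X ∧ G.Adj v w}

/-- Menger's theorem between `X` and `B`, inside `Y` and outside the interior of `X`. -/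
theorem exists_linkage_of_forall_le_ncard [Finite V] {G : SimpleGraph V} {X Y B : Set V}
    (hXY : X ⊆ Y) (hBX : B ∩ X ⊆ G.innerBoundary X)
    (h : ∀ Z, X ⊆ Z → Z ⊆ Y → (G.innerBoundary X).ncard ≤
      {v | v ∈ Z ∧ (v ∈ B ∨ ∃ w ∈ Y, w ∉ Z ∧ G.Adj v w)}.ncard) :
    ∃ P : V → Set V, (G.innerBoundary X).PairwiseDisjoint P ∧
      ∀ a ∈ G.innerBoundary X, a ∈ P a ∧ (G.induce (P a)).Connected ∧ (P a ∩ B).Nonempty ∧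
        P a ⊆ Y ∧ P a ∩ X ⊆ {a} := by
  set D := G.innerBoundary X with hD
  have hDX : D ⊆ X := fun v hv => hv.1
  -- With the interior of `X` removed, a linking set meets `X` only in `D`, and by disjointness only
  -- in its own end.
  have hL : (G.restrict (Y \ (X \ D))).Linked D B D.ncard := by
    refine linked_of_forall_le_ncard_exitSet _ _ _ _ fun T hT => ?_
    refine (h ((T ∪ X) ∩ Y) (Set.subset_inter Set.subset_union_right hXY)
      Set.inter_subset_right).trans (Set.ncard_le_ncard ?_ (Set.toFinite _))
    rintro v ⟨⟨hvTX, hvY⟩, hv | ⟨w, hwY, hw, hvw⟩⟩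
    · exact ⟨hvTX.elim id fun hvX => hT (hBX ⟨hv, hvX⟩), Or.inl hv⟩
    · have hwT : w ∉ T := fun h1 => hw ⟨Or.inl h1, hwY⟩
      have hwX : w ∉ X := fun h1 => hw ⟨Or.inr h1, hwY⟩
      have hvD : v ∈ X → v ∈ D := fun hvX => ⟨hvX, w, hwX, hvw⟩
      exact ⟨hvTX.elim id fun hvX => hT (hvD hvX), Or.inr ⟨w, hwT, hvw,
        ⟨hvY, fun h1 => h1.2 (hvD h1.1)⟩, ⟨hwY, fun h1 => hwX h1.1⟩⟩⟩
  obtain ⟨P, hPd, hP⟩ := hL.exists_indexed le_rfl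
  refine ⟨P, hPd, fun a ha => ?_⟩
  have hsub : P a ⊆ Y \ (X \ D) := subset_of_connected_induce_restrict (hP a ha).2.1
    ⟨a, (hP a ha).1, hXY (hDX ha), fun h1 => h1.2 ha⟩
  refine ⟨(hP a ha).1, connected_induce_mono (restrict_le _ _) (hP a ha).2.1, (hP a ha).2.2,
    fun v hv => (hsub hv).1, ?_⟩
  rintro v ⟨hv, hvX⟩
  have hvD : v ∈ D := by
    by_contra h1
    exact (hsub hv).2 ⟨hvX, h1⟩
  by_contra hne
  exact Set.disjoint_left.1 (hPd hvD ha hne) (hP v hvD).1 hv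

end Menger

/-! ### Focused path decompositions and exposed sets. -/

section Focused

variable {V : Type*}

/-- A path decomposition of `G[X]` with bags `U 0, U 1, …` that is focused on `S`: the set `H`
contains `S ∩ X`, meets each bag in at most `N` vertices, and each vertex of `X` outside `H` lies in
only one bag. -/
structure IsFocusedDecomposition (G : SimpleGraph V) (S X H : Set V) (U : ℕ → Set V) (N : ℕ) :
    Prop where
  bag_subset : ∀ j, U j ⊆ X
  subset : H ⊆ X
  focus : S ∩ X ⊆ H
  cover : ∀ v ∈ X, ∃ j, v ∈ U j
  edge : ∀ u ∈ X, ∀ v ∈ X, G.Adj u v → ∃ j, u ∈ U j ∧ v ∈ U j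
  consecutive : ∀ v i j k, i ≤ j → j ≤ k → v ∈ U i → v ∈ U k → v ∈ U j
  unique : ∀ v, v ∉ H → ∀ i j, v ∈ U i → v ∈ U j → i = j
  width : ∀ j, (U j ∩ H).ncard ≤ N

/-- `G[X]` has a focused decomposition whose first bag exposes the inner boundary of `X`. -/
def IsExposed (G : SimpleGraph V) (S : Set V) (N : ℕ) (X : Set V) : Prop :=
  ∃ U H, G.IsFocusedDecomposition S X H U N ∧ G.innerBoundary X ⊆ U 0 ∧ G.innerBoundary X ⊆ H

variable {G : SimpleGraph V} {S : Set V} {N : ℕ}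

/-- If `P` misses `U j`, no edge of `P` leaves the vertices in earlier bags: its ends share a bag,
and one from `j` on would force a vertex of `P` into `U j`. -/
theorem IsFocusedDecomposition.inter_bag_nonempty {X H : Set V} {U : ℕ → Set V}
    (hU : G.IsFocusedDecomposition S X H U N) {P : Set V} (hP : (G.induce P).Connected)
    (hPX : P ⊆ X) {i j k : ℕ} (hij : i ≤ j) (hjk : j ≤ k) (hi : (P ∩ U i).Nonempty)
    (hk : (P ∩ U k).Nonempty) : (P ∩ U j).Nonempty := by
  by_contra hcon
  have hj : ∀ v ∈ P, v ∉ U j := fun v hv hv' => hcon ⟨v, hv, hv'⟩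
  have hlt : i < j := lt_of_le_of_ne hij fun h => hcon (h ▸ hi)
  have hsub : P ⊆ {v | ∃ l < j, v ∈ U l} := by
    refine subset_of_connected_induce hP ?_ ?_
    · obtain ⟨v, hv, hvi⟩ := hi
      exact ⟨v, hv, i, hlt, hvi⟩
    · rintro u hu ⟨l, hl, hul⟩ w hw huw
      obtain ⟨m, hum, hwm⟩ := hU.edge u (hPX hu) w (hPX hw) huw
      refine ⟨m, ?_, hwm⟩
      by_contra hm
      exact hj u hu (hU.consecutive u l j m hl.le (not_lt.1 hm) hul hum)
  obtain ⟨v, hv, hvk⟩ := hk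
  obtain ⟨l, hl, hvl⟩ := hsub hv
  exact hj v hv (hU.consecutive v l j k hl.le hjk hvl hvk)

theorem isExposed_empty : G.IsExposed S N ∅ := by
  refine ⟨fun _ => ∅, ∅, ⟨?_, ?_, ?_, ?_, ?_, ?_, ?_, ?_⟩, ?_, ?_⟩ <;> simp [innerBoundary]

/-- An exposed set can be enlarged by a single new bag. -/
theorem IsExposed.extend [Finite V] {X Z : Set V} (hX : G.IsExposed S N X) (hXZ : X ⊆ Z)
    (hcard : (G.innerBoundary X ∪ (G.innerBoundary Z ∪ (S ∩ Z) \ X)).ncard ≤ N) :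
    G.IsExposed S N Z := by
  obtain ⟨U, H, hU, h0, hH⟩ := hX
  have hbd : ∀ v, v ∈ G.innerBoundary Z → v ∈ X → v ∈ G.innerBoundary X := by
    rintro v ⟨hv, w, hw, hvw⟩ hvX
    exact ⟨hvX, w, fun h => hw (hXZ h), hvw⟩
  -- All of `Z \ X` goes into the new first bag, however large: outside `H` only uniqueness matters,
  -- not size.
  let Q : Set V := G.innerBoundary X ∪ Z \ X
  have hQZ : Q ⊆ Z := Set.union_subset (fun v hv => hXZ hv.1) Set.sdiff_subset
  have hQX : ∀ v ∈ Q, v ∈ X → v ∈ G.innerBoundary X := by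
    rintro v (hv | hv) hvX
    · exact hv
    · exact absurd hvX hv.2
  have hedge : ∀ u ∈ Z, ∀ v ∈ Z, v ∉ X → G.Adj u v → u ∈ Q := by
    intro u hu v hv hvX huv
    by_cases huX : u ∈ X
    · exact Or.inl ⟨huX, v, hvX, huv⟩
    · exact Or.inr ⟨hu, huX⟩
  refine ⟨fun j => Nat.casesOn j Q U, H ∪ (G.innerBoundary Z ∪ S ∩ Z) \ X,
    ⟨?_, ?_, ?_, ?_, ?_, ?_, ?_, ?_⟩, ?_, ?_⟩
  · rintro (_ | j)
    · exact hQZ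
    · exact (hU.bag_subset j).trans hXZ
  · refine Set.union_subset (hU.subset.trans hXZ) ?_
    rintro v ⟨hv | hv, -⟩
    · exact hv.1
    · exact hv.2
  · rintro v hv
    by_cases hvX : v ∈ X
    · exact Or.inl (hU.focus ⟨hv.1, hvX⟩)
    · exact Or.inr ⟨Or.inr hv, hvX⟩
  · intro v hv
    by_cases hvX : v ∈ X
    · obtain ⟨j, hj⟩ := hU.cover v hvX
      exact ⟨j + 1, hj⟩
    · exact ⟨0, Or.inr ⟨hv, hvX⟩⟩
  · intro u hu v hv huv
    by_cases hvX : v ∈ X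
    · by_cases huX : u ∈ X
      · obtain ⟨j, hj⟩ := hU.edge u huX v hvX huv
        exact ⟨j + 1, hj⟩
      · exact ⟨0, Or.inr ⟨hu, huX⟩, hedge v hv u hu huX huv.symm⟩
    · exact ⟨0, hedge u hu v hv hvX huv, Or.inr ⟨hv, hvX⟩⟩
  · rintro v (_ | i) (_ | j) (_ | k) hij hjk hi hk
    · exact hi
    · exact hi
    · omega
    · have hvX := hU.bag_subset k hk
      exact hU.consecutive v 0 j k (Nat.zero_le _) (by omega) (h0 (hQX v hi hvX)) hk
    · omega
    · omega
    · omega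
    · exact hU.consecutive v i j k (by omega) (by omega) hi hk
  · rintro v hv (_ | i) (_ | j) hi hj
    · rfl
    · exact absurd (Or.inl (hH (hQX v hi (hU.bag_subset j hj)))) hv
    · exact absurd (Or.inl (hH (hQX v hj (hU.bag_subset i hi)))) hv
    · rw [hU.unique v (fun h => hv (Or.inl h)) i j hi hj]
  · rintro (_ | j)
    · refine (Set.ncard_le_ncard ?_ (Set.toFinite _)).trans hcard
      rintro v ⟨hvQ, hvH | ⟨hv | hv, hvX⟩⟩
      · exact Or.inl (hQX v hvQ (hU.subset hvH))
      · exact Or.inr (Or.inl hv)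
      · exact Or.inr (Or.inr ⟨hv, hvX⟩)
    · refine (Set.ncard_le_ncard ?_ (Set.toFinite _)).trans (hU.width j)
      rintro v ⟨hv, hvH | ⟨-, hvX⟩⟩
      · exact ⟨hv, hvH⟩
      · exact absurd (hU.bag_subset j hv) hvX
  · intro v hv
    by_cases hvX : v ∈ X
    · exact Or.inl (hbd v hv hvX)
    · exact Or.inr ⟨hv.1, hvX⟩
  · intro v hv
    by_cases hvX : v ∈ X
    · exact Or.inl (hH (hbd v hv hvX))
    · exact Or.inr ⟨Or.inl hv, hvX⟩

/-- Exposedness passes to subsets whose inner boundary is linked to that of the larger set. -/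
theorem IsExposed.of_linkage [Finite V] {Y Z : Set V} (hY : G.IsExposed S N Y) (hZY : Z ⊆ Y)
    {P : V → Set V} (hPd : (G.innerBoundary Z).PairwiseDisjoint P)
    (hP : ∀ a ∈ G.innerBoundary Z, a ∈ P a ∧ (G.induce (P a)).Connected ∧
      (P a ∩ G.innerBoundary Y).Nonempty ∧ P a ⊆ Y ∧ P a ∩ Z ⊆ {a}) :
    G.IsExposed S N Z := by
  classical
  obtain ⟨U, H, hU, h0, hH⟩ := hY
  -- Each `P z` is contracted onto `z`: the vertex `z` enters every bag that `P z` meets.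
  let Q : V → Set V := fun z => if z ∈ G.innerBoundary Z then P z else {z}
  have hQ1 : ∀ z, z ∈ G.innerBoundary Z → Q z = P z := fun z hz => if_pos hz
  have hQ2 : ∀ z, z ∉ G.innerBoundary Z → Q z = {z} := fun z hz => if_neg hz
  have hself : ∀ z, z ∈ Q z := by
    intro z
    by_cases hz : z ∈ G.innerBoundary Z
    · rw [hQ1 z hz]; exact (hP z hz).1
    · rw [hQ2 z hz]; rfl
  have hconn : ∀ z, (G.induce (Q z)).Connected := by
    intro z
    by_cases hz : z ∈ G.innerBoundary Z
    · rw [hQ1 z hz]; exact (hP z hz).2.1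
    · rw [hQ2 z hz]; exact connected_induce_singleton z
  have hQY : ∀ z ∈ Z, Q z ⊆ Y := by
    intro z hzZ
    by_cases hz : z ∈ G.innerBoundary Z
    · rw [hQ1 z hz]; exact (hP z hz).2.2.2.1
    · rw [hQ2 z hz]; exact Set.singleton_subset_iff.2 (hZY hzZ)
  have hQZ : ∀ z, Q z ∩ Z ⊆ {z} := by
    intro z
    by_cases hz : z ∈ G.innerBoundary Z
    · rw [hQ1 z hz]; exact (hP z hz).2.2.2.2
    · rw [hQ2 z hz]; exact Set.inter_subset_left
  have hdisj : ∀ z ∈ Z, ∀ z' ∈ Z, ∀ w, w ∈ Q z → w ∈ Q z' → z = z' := by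
    intro z hz z' hz' w hw hw'
    by_cases h1 : z ∈ G.innerBoundary Z
    · by_cases h2 : z' ∈ G.innerBoundary Z
      · rw [hQ1 z h1] at hw
        rw [hQ1 z' h2] at hw'
        by_contra hne
        exact Set.disjoint_left.1 (hPd h1 h2 hne) hw hw'
      · rw [hQ2 z' h2] at hw'
        obtain rfl : w = z' := hw'
        exact (hQZ z ⟨hw, hz'⟩).symm
    · rw [hQ2 z h1] at hw
      obtain rfl : w = z := hw
      exact hQZ z' ⟨hw', hz⟩
  -- If `Q z` avoided `H` in `U j` it could never leave that bag, yet it ends in the boundary of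
  -- `Y`, which lies in `H`. The disjoint sets `Q z` thus have distinct representatives in `U j ∩
  -- H`, and the width does not grow.
  have hmeet : ∀ z ∈ G.innerBoundary Z, ∀ j, (Q z ∩ U j).Nonempty → (Q z ∩ (U j ∩ H)).Nonempty := by
    intro z hz j hj
    by_contra hcon
    have hno : ∀ v ∈ Q z, v ∈ U j → v ∉ H := fun v hv hvj hvH => hcon ⟨v, hv, hvj, hvH⟩
    have hsub : Q z ⊆ U j := by
      refine subset_of_connected_induce (hconn z) hj ?_
      intro u hu huj w hw huw
      obtain ⟨m, hum, hwm⟩ := hU.edge u (hQY z hz.1 hu) w (hQY z hz.1 hw) huw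
      rwa [hU.unique u (hno u hu huj) j m huj hum]
    obtain ⟨v, hv, hvY⟩ := (hP z hz).2.2.1
    rw [← hQ1 z hz] at hv
    exact hno v hv (hsub hv) (hH hvY)
  refine ⟨fun j => {z | z ∈ Z ∧ (Q z ∩ U j).Nonempty}, H ∩ Z ∪ G.innerBoundary Z,
    ⟨?_, ?_, ?_, ?_, ?_, ?_, ?_, ?_⟩, ?_, ?_⟩
  · exact fun j z hz => hz.1
  · exact Set.union_subset Set.inter_subset_right fun v hv => hv.1
  · exact fun v hv => Or.inl ⟨hU.focus ⟨hv.1, hZY hv.2⟩, hv.2⟩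
  · intro v hv
    obtain ⟨j, hj⟩ := hU.cover v (hZY hv)
    exact ⟨j, hv, v, hself v, hj⟩
  · intro u hu v hv huv
    obtain ⟨j, hj, hj'⟩ := hU.edge u (hZY hu) v (hZY hv) huv
    exact ⟨j, ⟨hu, u, hself u, hj⟩, ⟨hv, v, hself v, hj'⟩⟩
  · rintro v i j k hij hjk ⟨hv, hi⟩ ⟨-, hk⟩
    exact ⟨hv, hU.inter_bag_nonempty (hconn v) (hQY v hv) hij hjk hi hk⟩
  · rintro v hv i j ⟨hvZ, hi⟩ ⟨-, hj⟩
    rw [hQ2 v fun h => hv (Or.inr h)] at hi hj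
    rw [Set.singleton_inter_nonempty] at hi hj
    exact hU.unique v (fun h => hv (Or.inl ⟨h, hvZ⟩)) i j hi hj
  · intro j
    have key : ∀ z ∈ {z | z ∈ Z ∧ (Q z ∩ U j).Nonempty} ∩ (H ∩ Z ∪ G.innerBoundary Z),
        ∃ w, w ∈ Q z ∧ w ∈ U j ∩ H := by
      rintro z ⟨⟨hzZ, hz⟩, hzH⟩
      by_cases hzb : z ∈ G.innerBoundary Z
      · exact hmeet z hzb j hz
      · rw [hQ2 z hzb, Set.singleton_inter_nonempty] at hz
        exact ⟨z, hself z, hz, (hzH.resolve_right hzb).1⟩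
    choose! f hf using key
    refine (Set.ncard_le_ncard_of_injOn f (fun z hz => (hf z hz).2) ?_ (Set.toFinite _)).trans
      (hU.width j)
    intro z hz z' hz' hff
    exact hdisj z hz.1.1 z' hz'.1.1 (f z) (hf z hz).1 (hff ▸ (hf z' hz').1)
  · intro z hz
    obtain ⟨v, hv, hvY⟩ := (hP z hz).2.2.1
    exact ⟨hz.1, v, (hQ1 z hz).symm ▸ hv, h0 hvY⟩
  · exact Set.subset_union_right

/-- A linkage from `X` to the boundary of an exposed set `Y`, provided that no exposed set between
them has a smaller boundary than `X`. -/
theorem IsExposed.exists_linkage [Finite V] {X Y : Set V} (hY : G.IsExposed S N Y) (hXY : X ⊆ Y)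
    (hmin : ∀ Z, X ⊆ Z → Z ⊆ Y → G.IsExposed S N Z →
      (G.innerBoundary X).ncard ≤ (G.innerBoundary Z).ncard) :
    ∃ P : V → Set V, (G.innerBoundary X).PairwiseDisjoint P ∧
      ∀ a ∈ G.innerBoundary X, a ∈ P a ∧ (G.induce (P a)).Connected ∧
        (P a ∩ G.innerBoundary Y).Nonempty ∧ P a ⊆ Y ∧ P a ∩ X ⊆ {a} := by
  have link : ∀ X', X' ⊆ Y → (∀ Z, X' ⊆ Z → Z ⊆ Y →
      (G.innerBoundary X').ncard ≤ (G.innerBoundary Z).ncard) →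
      ∃ P : V → Set V, (G.innerBoundary X').PairwiseDisjoint P ∧
      ∀ a ∈ G.innerBoundary X', a ∈ P a ∧ (G.induce (P a)).Connected ∧
        (P a ∩ G.innerBoundary Y).Nonempty ∧ P a ⊆ Y ∧ P a ∩ X' ⊆ {a} := by
    intro X' hX'Y hmin'
    refine exists_linkage_of_forall_le_ncard hX'Y ?_ fun Z hXZ hZY => (hmin' Z hXZ hZY).trans
      (Set.ncard_le_ncard ?_ (Set.toFinite _))
    · rintro v ⟨⟨-, w, hw, hvw⟩, hvX⟩
      exact ⟨hvX, w, fun h => hw (hX'Y h), hvw⟩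
    · rintro v ⟨hvZ, w, hw, hvw⟩
      by_cases hwY : w ∈ Y
      · exact ⟨hvZ, Or.inr ⟨w, hwY, hw, hvw⟩⟩
      · exact ⟨hvZ, Or.inl ⟨hZY hvZ, w, hwY, hvw⟩⟩
  -- `hmin` covers only exposed sets, while Menger's theorem needs all sets. One with smallest
  -- boundary is linked to `Y`, hence exposed, so the bound passes to all.
  obtain ⟨Z, ⟨hXZ, hZY⟩, hZmin⟩ := (Set.toFinite {Z | X ⊆ Z ∧ Z ⊆ Y}).exists_minimalFor
    (fun Z => (G.innerBoundary Z).ncard) _ ⟨X, subset_rfl, hXY⟩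
  have hZmin' : ∀ T, X ⊆ T → T ⊆ Y → (G.innerBoundary Z).ncard ≤ (G.innerBoundary T).ncard := by
    intro T hXT hTY
    rcases le_total (G.innerBoundary Z).ncard (G.innerBoundary T).ncard with h | h
    · exact h
    · exact hZmin ⟨hXT, hTY⟩ h
  obtain ⟨P, hPd, hP⟩ := link Z hZY fun T hZT hTY => hZmin' T (hXZ.trans hZT) hTY
  have hZ := hY.of_linkage hZY hPd hP
  exact link X hXY fun T hXT hTY => (hmin Z hXZ hZY hZ).trans (hZmin' T hXT hTY)

end Focused

/-! ### Growing a rooted model of a forest. -/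

section ForestModels

variable {V W : Type*} {G : SimpleGraph V} {S : Set V} {N : ℕ}

theorem pairwiseDisjoint_union_linkage {B : W → Set V} {P : V → Set V} {b : W → V} {A : Set W}
    {D X : Set V} (hBd : A.PairwiseDisjoint B) (hBX : ∀ t ∈ A, B t ⊆ X)
    (hb : ∀ t ∈ A, b t ∈ B t ∧ b t ∈ D) (hPd : D.PairwiseDisjoint P)
    (hPX : ∀ a ∈ D, P a ∩ X ⊆ {a}) : A.PairwiseDisjoint fun t => B t ∪ P (b t) := by
  have cross : ∀ s ∈ A, ∀ t ∈ A, s ≠ t → ∀ v ∈ B s, v ∉ P (b t) := by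
    intro s hs t ht hst v hv hv'
    obtain rfl : v = b t := hPX _ (hb t ht).2 ⟨hv', hBX s hs hv⟩
    exact Set.disjoint_left.1 (hBd hs ht hst) hv (hb t ht).1
  intro s hs t ht hst
  refine Set.disjoint_left.2 ?_
  rintro v (hv | hv) (hv' | hv')
  · exact Set.disjoint_left.1 (hBd hs ht hst) hv hv'
  · exact cross s hs t ht hst v hv hv'
  · exact cross t ht s hs hst.symm v hv' hv
  · refine Set.disjoint_left.1 (hPd (hb s hs).2 (hb t ht).2 fun h => ?_) hv hv'
    exact Set.disjoint_left.1 (hBd hs ht hst) (hb s hs).1 (h ▸ (hb t ht).1)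

/-- A model in `G[X]` of the subgraph of `F` induced by `A`, all of whose branch sets meet the inner
boundary of `X`. -/
structure IsBoundaryModel (F : SimpleGraph W) (G : SimpleGraph V) (A : Set W) (X : Set V)
    (B : W → Set V) : Prop where
  subset : ∀ t ∈ A, B t ⊆ X
  connected : ∀ t ∈ A, (G.induce (B t)).Connected
  boundary : ∀ t ∈ A, (B t ∩ G.innerBoundary X).Nonempty
  disjoint : A.PairwiseDisjoint B
  adj : ∀ s ∈ A, ∀ t ∈ A, F.Adj s t → ∃ u ∈ B s, ∃ v ∈ B t, G.Adj u v

/-- `X` is exposed, has at most `i` boundary vertices, and is maximal with these properties. -/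
def IsMaximalExposed (G : SimpleGraph V) (S : Set V) (N i : ℕ) (X : Set V) : Prop :=
  Maximal (fun Y => G.IsExposed S N Y ∧ (G.innerBoundary Y).ncard ≤ i) X

/-- A leaf `t` of `F[A]` is added to a model for `A - t`, starting from a vertex `y` outside `X`
that is adjacent to the branch set of the parent of `t`, if any. By maximality of `X`, every exposed
set containing `X + y` has at least `|A|` boundary vertices; this gives the linkage to a maximal
exposed set for `|A|`. -/
theorem exists_boundaryModel [Finite V] {F : SimpleGraph W} (hF : F.IsAcyclic)
    (hV : ¬ G.IsExposed S N Set.univ) (A : Finset W) (hA : A.card ≤ N) :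
    ∃ X B, G.IsMaximalExposed S N A.card X ∧ (G.innerBoundary X).ncard = A.card ∧
      IsBoundaryModel F G A X B := by
  classical
  induction A using Finset.strongInduction with
  | H A ih =>
  rcases A.eq_empty_or_nonempty with rfl | hne
  · obtain ⟨X, -, hX⟩ := Finite.exists_le_maximal
      (p := fun Y => G.IsExposed S N Y ∧ (G.innerBoundary Y).ncard ≤ 0) (a := (∅ : Set V))
      ⟨isExposed_empty, by simp [innerBoundary]⟩
    refine ⟨X, fun _ => ∅, hX, Nat.le_zero.1 hX.prop.2, ?_, ?_, ?_, ?_, ?_⟩ <;> simp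
  obtain ⟨t, ht, hleaf⟩ := hF.exists_leaf hne
  have hcard := Finset.card_erase_add_one ht
  obtain ⟨X, B, hX, hXcard, hB⟩ := ih (A.erase t) (Finset.erase_ssubset ht) (by omega)
  set i := (A.erase t).card with hi
  have hout : ∃ y, y ∉ X := by
    by_contra hcon
    push Not at hcon
    exact hV (Set.eq_univ_of_forall hcon ▸ hX.prop.1)
  have : Nonempty V := ⟨hout.choose⟩
  choose! b hb using hB.boundary
  obtain ⟨y, hyX, hy⟩ : ∃ y, y ∉ X ∧
      ∀ s ∈ A.erase t, F.Adj t s → ∃ u ∈ B s, G.Adj u y := by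
    by_cases hpar : ∃ s ∈ A.erase t, F.Adj t s
    · obtain ⟨s, hs, hts⟩ := hpar
      obtain ⟨-, y, hyX, hy⟩ := (hb s hs).2
      refine ⟨y, hyX, fun s' hs' hts' => ?_⟩
      obtain rfl := hleaf s (Finset.mem_of_mem_erase hs) s' (Finset.mem_of_mem_erase hs') hts hts'
      exact ⟨b s, (hb s hs).1, hy⟩
    · obtain ⟨y, hy⟩ := hout
      exact ⟨y, hy, fun s hs hts => absurd ⟨s, hs, hts⟩ hpar⟩
  set X' := insert y X with hX'
  have hXX' : X ⊆ X' := Set.subset_insert _ _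
  have hbd : G.innerBoundary X' ⊆ insert y (G.innerBoundary X) := by
    rintro v ⟨hv | hv, w, hw, hvw⟩
    · exact Or.inl hv
    · exact Or.inr ⟨hv, w, fun h => hw (hXX' h), hvw⟩
  have hins : (insert y (G.innerBoundary X)).ncard = A.card := by
    rw [Set.ncard_insert_of_notMem fun h => hyX h.1, hXcard, hcard]
  have hbig : ∀ Z, X' ⊆ Z → G.IsExposed S N Z → A.card ≤ (G.innerBoundary Z).ncard := by
    intro Z hZ hZe
    by_contra hlt
    have := hX.le_of_ge ⟨hZe, by omega⟩ (hXX'.trans hZ)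
    exact hyX (this (hZ (Set.mem_insert _ _)))
  have hX'e : G.IsExposed S N X' := by
    refine hX.prop.1.extend hXX' ((Set.ncard_le_ncard ?_ (Set.toFinite _)).trans (hins.trans_le hA))
    refine Set.union_subset (Set.subset_insert _ _) (Set.union_subset hbd ?_)
    rintro v ⟨⟨-, hv | hv⟩, hvX⟩
    · exact Or.inl hv
    · exact absurd hv hvX
  have hbd' : G.innerBoundary X' = insert y (G.innerBoundary X) :=
    Set.eq_of_subset_of_ncard_le hbd (hins.trans_le (hbig X' subset_rfl hX'e)) (Set.toFinite _)
  obtain ⟨Y, hX'Y, hY⟩ := Finite.exists_le_maximal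
    (p := fun Y => G.IsExposed S N Y ∧ (G.innerBoundary Y).ncard ≤ A.card) (a := X')
    ⟨hX'e, (hbd' ▸ hins).le⟩
  obtain ⟨P, hPd, hP⟩ := hY.prop.1.exists_linkage hX'Y fun Z hZ _ hZe =>
    ((hbd' ▸ hins).le).trans (hbig Z hZ hZe)
  have hyD : y ∈ G.innerBoundary X' := hbd' ▸ Set.mem_insert _ _
  have hbD : ∀ s ∈ A.erase t, b s ∈ G.innerBoundary X' := fun s hs =>
    hbd' ▸ Set.mem_insert_of_mem _ (hb s hs).2
  let C : W → Set V := fun s => if s = t then P y else B s ∪ P (b s)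
  have hCt : C t = P y := if_pos rfl
  have hCs : ∀ s ∈ A.erase t, C s = B s ∪ P (b s) := fun s hs => if_neg (Finset.ne_of_mem_erase hs)
  have hcases : ∀ s ∈ A, s = t ∨ s ∈ A.erase t := fun s hs => by
    by_cases h : s = t
    · exact Or.inl h
    · exact Or.inr (Finset.mem_erase.2 ⟨h, hs⟩)
  have hPX : ∀ a ∈ G.innerBoundary X', P a ∩ X ⊆ {a} := fun a ha =>
    (Set.inter_subset_inter_right _ hXX').trans (hP a ha).2.2.2.2
  have hdisj := pairwiseDisjoint_union_linkage hB.disjoint hB.subset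
    (fun s hs => ⟨(hb s hs).1, hbD s hs⟩) hPd hPX
  have hdisjt : ∀ s ∈ A.erase t, Disjoint (P y) (C s) := by
    intro s hs
    rw [hCs s hs, Set.disjoint_left]
    rintro v hv (hv' | hv')
    · have hvX := hB.subset s hs hv'
      obtain rfl : v = y := hPX y hyD ⟨hv, hvX⟩
      exact hyX hvX
    · refine Set.disjoint_left.1 (hPd hyD (hbD s hs) fun h => ?_) hv hv'
      exact hyX (h ▸ (hb s hs).2.1)
  have hadjt : ∀ s ∈ A.erase t, F.Adj t s → ∃ u ∈ C t, ∃ v ∈ C s, G.Adj u v := by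
    intro s hs hts
    obtain ⟨u, hu, huy⟩ := hy s hs hts
    refine ⟨y, hCt ▸ (hP y hyD).1, u, ?_, huy.symm⟩
    rw [hCs s hs]
    exact Or.inl hu
  refine ⟨Y, C, hY, le_antisymm hY.prop.2 (hbig Y hX'Y hY.prop.1), ?_, ?_, ?_, ?_, ?_⟩
  · intro s hs
    rcases hcases s hs with rfl | hs'
    · rw [hCt]; exact (hP y hyD).2.2.2.1
    · rw [hCs s hs']
      exact Set.union_subset ((hB.subset s hs').trans (hXX'.trans hX'Y))
        (hP _ (hbD s hs')).2.2.2.1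
  · intro s hs
    rcases hcases s hs with rfl | hs'
    · rw [hCt]; exact (hP y hyD).2.1
    · rw [hCs s hs']
      exact induce_union_connected (hB.connected s hs').preconnected
        (hP _ (hbD s hs')).2.1.preconnected ⟨b s, (hb s hs').1, (hP _ (hbD s hs')).1⟩
  · intro s hs
    rcases hcases s hs with rfl | hs'
    · rw [hCt]; exact (hP y hyD).2.2.1
    · rw [hCs s hs']
      exact (hP _ (hbD s hs')).2.2.1.mono (Set.inter_subset_inter_left _ Set.subset_union_right)
  · intro s hs r hr hsr
    rcases hcases s hs with rfl | hs' <;> rcases hcases r hr with rfl | hr'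
    · exact absurd rfl hsr
    · change Disjoint (C s) (C r)
      rw [hCt]; exact hdisjt r hr'
    · change Disjoint (C s) (C r)
      rw [hCt]; exact (hdisjt s hs').symm
    · change Disjoint (C s) (C r)
      rw [hCs s hs', hCs r hr']
      exact hdisj hs' hr' hsr
  · intro s hs r hr hsr
    rcases hcases s hs with rfl | hs' <;> rcases hcases r hr with rfl | hr'
    · exact absurd hsr (F.loopless.irrefl _)
    · exact hadjt r hr' hsr
    · obtain ⟨u, hu, v, hv, huv⟩ := hadjt s hs' hsr.symm
      exact ⟨v, hv, u, hu, huv.symm⟩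
    · obtain ⟨u, hu, v, hv, huv⟩ := hB.adj s hs' r hr' hsr
      refine ⟨u, ?_, v, ?_, huv⟩
      · rw [hCs s hs']; exact Or.inl hu
      · rw [hCs r hr']; exact Or.inl hv

/-- A graph without a model of the forest `F` whose branch sets all meet `S` has a path
decomposition focused on `S` of width less than `2 * |F|`. -/
theorem exists_isFocusedDecomposition_of_no_rooted_model [Finite V] [Fintype W] [Nonempty W]
    {F : SimpleGraph W} (hF : F.IsAcyclic)
    (hno : ¬ ∃ M : MinorModel F G, ∀ t, (M.branch t ∩ S).Nonempty) :
    ∃ H U, G.IsFocusedDecomposition S Set.univ H U (2 * Fintype.card W - 1) := by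
  classical
  set N := 2 * Fintype.card W - 1 with hN
  have hpos : 0 < Fintype.card W := Fintype.card_pos
  by_contra hcon
  have hV : ¬ G.IsExposed S N Set.univ := by
    rintro ⟨U, H, hU, -⟩
    exact hcon ⟨H, U, hU⟩
  obtain ⟨X, B, hX, hXcard, hB⟩ := exists_boundaryModel hF hV Finset.univ
    (by rw [Finset.card_univ]; omega)
  rw [Finset.card_univ] at hX hXcard
  obtain ⟨P, hPd, hP⟩ : ∃ P : V → Set V, (G.innerBoundary X).PairwiseDisjoint P ∧
      ∀ a ∈ G.innerBoundary X, a ∈ P a ∧ (G.induce (P a)).Connected ∧ (P a ∩ (S \ X)).Nonempty ∧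
        P a ⊆ Set.univ ∧ P a ∩ X ⊆ {a} := by
    refine exists_linkage_of_forall_le_ncard (Set.subset_univ X) (fun v hv => absurd hv.2 hv.1.2)
      fun Z hXZ _ => ?_
    -- Here `Q` has at most `|F| - 1` vertices, so one new bag with at most `|F| + (|F| - 1) = N`
    -- vertices of `H` exposes `Z`. Maximality gives `Z = X`, but then the `|F|` boundary vertices
    -- of `X` lie in `Q`.
    by_contra hlt
    set Q := {v | v ∈ Z ∧ (v ∈ S \ X ∨ ∃ w ∈ Set.univ, w ∉ Z ∧ G.Adj v w)} with hQ
    have hbdQ : G.innerBoundary Z ⊆ Q := by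
      rintro v ⟨hv, w, hw, hvw⟩
      exact ⟨hv, Or.inr ⟨w, trivial, hw, hvw⟩⟩
    have hZle := Set.ncard_le_ncard hbdQ (Set.toFinite _)
    have hZe : G.IsExposed S N Z := by
      refine hX.prop.1.extend hXZ ((Set.ncard_le_ncard (Set.union_subset_union_right _
        (Set.union_subset hbdQ ?_)) (Set.toFinite _)).trans ((Set.ncard_union_le _ Q).trans ?_))
      · rintro v ⟨⟨hvS, hvZ⟩, hvX⟩
        exact ⟨hvZ, Or.inl ⟨hvS, hvX⟩⟩
      · omega
    have hZX : Z = X := (hX.eq_of_le ⟨hZe, by omega⟩ hXZ).symm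
    rw [hZX] at hZle
    omega
  choose b hb using fun t => hB.boundary t (by simp)
  have hdisj := pairwiseDisjoint_union_linkage hB.disjoint hB.subset
    (fun s _ => hb s) hPd fun a ha => (hP a ha).2.2.2.2
  refine hno ⟨⟨fun t => B t ∪ P (b t), ?_, ?_, ?_⟩, ?_⟩
  · exact fun s t hst => hdisj (by simp) (by simp) hst
  · exact fun s => induce_union_connected (hB.connected s (by simp)).preconnected
      (hP _ (hb s).2).2.1.preconnected ⟨b s, (hb s).1, (hP _ (hb s).2).1⟩
  · intro s t hst
    obtain ⟨u, hu, v, hv, huv⟩ := hB.adj s (by simp) t (by simp) hst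
    exact ⟨u, Or.inl hu, v, Or.inl hv, huv⟩
  · intro t
    obtain ⟨v, hv, hvS⟩ := (hP _ (hb t).2).2.2.1
    exact ⟨v, Or.inr hv, hvS.1⟩

end ForestModels

/-! ### Hubs in the role of the apex. -/

section Hubs

variable {V W : Type*} {G : SimpleGraph V} {S : Set V} {N : ℕ}

/-- A connected set disjoint from `C` that contains every neighbour of `C`. -/
structure IsHub (G : SimpleGraph V) (C A : Set V) : Prop where
  connected : (G.induce A).Connected
  disjoint : Disjoint A C
  mem_of_adj : ∀ v ∈ C, ∀ w, w ∉ C → G.Adj v w → w ∈ A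

/-- A rooted model of `X - a` in `G[C]`, together with `A` as branch set of `a`, would be a model of
`X`. The width is `2(|W| - 1) - 1`. -/
theorem IsHub.exists_isFocusedDecomposition [Finite V] [Fintype W] {X : SimpleGraph W} {a : W}
    [Nonempty ({a}ᶜ : Set W)] (hX : (X.induce {a}ᶜ).IsAcyclic) (hG : ¬ X.IsMinor G) {C A : Set V}
    (hA : G.IsHub C A) :
    ∃ H U, G.IsFocusedDecomposition (G.innerBoundary C) C H U (2 * Fintype.card W - 3) := by
  classical
  have hcard : 2 * Fintype.card W - 3 = 2 * Fintype.card ({a}ᶜ : Set W) - 1 := by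
    rw [Fintype.card_compl_set, Set.card_singleton]
    omega
  rw [hcard]
  obtain ⟨H, U, hU⟩ := exists_isFocusedDecomposition_of_no_rooted_model
      (G := G.restrict C) (S := G.innerBoundary C) hX <| by
    rintro ⟨M, hM⟩
    have hMC : ∀ t, M.branch t ⊆ C := fun t =>
      subset_of_connected_induce_restrict (M.connected t)
        ((hM t).mono (Set.inter_subset_inter_right _ fun v hv => hv.1))
    have hroot : ∀ t, ∃ u ∈ M.branch t, ∃ v ∈ A, G.Adj u v := by
      intro t
      obtain ⟨u, hu, huC, w, hw, huw⟩ := hM t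
      exact ⟨u, hu, w, hA.mem_of_adj u huC w hw huw, huw⟩
    let B : W → Set V := fun w => if h : w = a then A else M.branch ⟨w, h⟩
    have hBa : B a = A := dif_pos rfl
    have hBw : ∀ w (h : w ≠ a), B w = M.branch ⟨w, h⟩ := fun w h => dif_neg h
    refine hG ⟨⟨B, ?_, ?_, ?_⟩⟩
    · intro x y hxy
      by_cases hx : x = a <;> by_cases hy : y = a
      · exact absurd (hx.trans hy.symm) hxy
      · rw [hx, hBa, hBw y hy]
        exact hA.disjoint.mono_right (hMC _)
      · rw [hy, hBa, hBw x hx]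
        exact (hA.disjoint.mono_right (hMC _)).symm
      · rw [hBw x hx, hBw y hy]
        exact M.disjoint _ _ fun h => hxy (congrArg Subtype.val h)
    · intro x
      by_cases hx : x = a
      · rw [hx, hBa]; exact hA.connected
      · rw [hBw x hx]; exact connected_induce_mono (restrict_le _ _) (M.connected _)
    · intro x y hxy
      by_cases hx : x = a <;> by_cases hy : y = a
      · exact absurd (hx.trans hy.symm) hxy.ne
      · rw [hx, hBa, hBw y hy]
        obtain ⟨u, hu, v, hv, huv⟩ := hroot ⟨y, hy⟩
        exact ⟨v, hv, u, hu, huv.symm⟩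
      · rw [hy, hBa, hBw x hx]
        exact hroot ⟨x, hx⟩
      · rw [hBw x hx, hBw y hy]
        obtain ⟨u, hu, v, hv, huv⟩ := M.adj ⟨x, hx⟩ ⟨y, hy⟩ hxy
        exact ⟨u, hu, v, hv, huv.1⟩
  refine ⟨H ∩ C, fun j => U j ∩ C, ?_, ?_, ?_, ?_, ?_, ?_, ?_, ?_⟩
  · exact fun j => Set.inter_subset_right
  · exact Set.inter_subset_right
  · exact fun v hv => ⟨hU.focus ⟨hv.1, trivial⟩, hv.2⟩
  · intro v hv
    obtain ⟨j, hj⟩ := hU.cover v trivial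
    exact ⟨j, hj, hv⟩
  · intro u hu v hv huv
    obtain ⟨j, hj, hj'⟩ := hU.edge u trivial v trivial ⟨huv, hu, hv⟩
    exact ⟨j, ⟨hj, hu⟩, ⟨hj', hv⟩⟩
  · intro v i j k hij hjk hi hk
    exact ⟨hU.consecutive v i j k hij hjk hi.1 hk.1, hi.2⟩
  · intro v hv i j hi hj
    exact hU.unique v (fun h => hv ⟨h, hi.2⟩) i j hi.1 hj.1
  · intro j
    exact (Set.ncard_le_ncard (Set.inter_subset_inter Set.inter_subset_left
      Set.inter_subset_left) (Set.toFinite _)).trans (hU.width j)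

/-- If `C` has a hub, then in a decomposition of `C` focused on its inner boundary with `H` smallest,
the part of each bag outside `H` has a hub as well. -/
theorem IsHub.exists_isFocusedDecomposition_forall_isHub [Finite V] {C A : Set V}
    (hA : G.IsHub C A)
    (hex : ∃ H U, G.IsFocusedDecomposition (G.innerBoundary C) C H U N) :
    ∃ H U, G.IsFocusedDecomposition (G.innerBoundary C) C H U N ∧
      ∀ j, ∃ A', G.IsHub (U j \ H) A' := by
  classical
  obtain ⟨H, ⟨U, hU⟩, hmin⟩ := (Set.toFinite {H | ∃ U, G.IsFocusedDecomposition
    (G.innerBoundary C) C H U N}).exists_minimal hex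
  refine ⟨H, U, hU, fun j => ?_⟩
  set D := U j \ H with hD
  have hDC : D ⊆ C := fun v hv => hU.bag_subset j hv.1
  -- The union of `T` is the component of `G - D` containing `A`; it is the new hub.
  set T := {T | (G.induce T).Connected ∧ A ⊆ T ∧ Disjoint T D} with hT
  have hAT : A ∈ T := ⟨hA.connected, subset_rfl, hA.disjoint.mono_right hDC⟩
  have hAne : A.Nonempty := Set.nonempty_coe_sort.1 hA.connected.nonempty
  have hAsub : A ⊆ ⋃₀ T := Set.subset_sUnion_of_mem hAT
  have hclosed : ∀ v ∈ ⋃₀ T, ∀ w, w ∉ D → G.Adj v w → w ∈ ⋃₀ T := by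
    rintro v ⟨R, hR, hv⟩ w hw hvw
    refine ⟨R ∪ {w}, ⟨?_, hR.2.1.trans Set.subset_union_left, ?_⟩, Or.inr rfl⟩
    · exact connected_induce_union hR.1.preconnected (connected_induce_singleton w).preconnected
        hv rfl hvw
    · exact Set.disjoint_union_left.2 ⟨hR.2.2, Set.disjoint_singleton_left.2 hw⟩
  refine ⟨⋃₀ T, ?_, Set.disjoint_sUnion_left.2 fun R hR => hR.2.2, ?_⟩
  · refine induce_sUnion_connected_of_pairwise_not_disjoint ⟨A, hAT⟩ ?_ fun h => h.1
    intro s t hs ht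
    exact hAne.mono (Set.subset_inter hs.2.1 ht.2.1)
  intro v hv w hw hvw
  by_contra hwT
  have hwC : w ∈ C := by
    by_contra hwC
    exact hv.2 (hU.focus ⟨⟨hDC hv, w, hwC, hvw⟩, hDC hv⟩)
  have hwH : w ∈ H := by
    obtain ⟨i, hvi, hwi⟩ := hU.edge v (hDC hv) w hwC hvw
    rw [hU.unique v hv.2 i j hvi hv.1] at hwi
    by_contra hwH
    exact hw ⟨hwi, hwH⟩
  -- `M` is the part of `C` that `D` cuts off from `A`. It can be moved into bag `j` alone and
  -- dropped from `H`: its neighbours in `C` lie in `D ∪ M`, and boundary vertices of `C` are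
  -- outside `D` and adjacent to `A`, so not in `M`. As `w` is in `H ∩ M`, this contradicts
  -- minimality of `H`.
  set M := (C \ D) \ ⋃₀ T with hM
  have hMU : ∀ u ∈ M, ∀ v ∈ C, G.Adj u v → v ∈ U j ∪ M := by
    intro u hu v hv huv
    by_cases hvD : v ∈ D
    · exact Or.inl hvD.1
    · exact Or.inr ⟨⟨hv, hvD⟩, fun hvT => hu.2 (hclosed v hvT u hu.1.2 huv.symm)⟩
  let U' : ℕ → Set V := fun i => if i = j then U j ∪ M else U i \ M
  have hU'j : U' j = U j ∪ M := if_pos rfl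
  have hU'i : ∀ v i, v ∉ M → (v ∈ U' i ↔ v ∈ U i) := by
    intro v i hv
    by_cases hi : i = j
    · rw [hi, hU'j]
      exact or_iff_left hv
    · simp only [U', if_neg hi]
      exact and_iff_left hv
  have hU'M : ∀ v i, v ∈ M → v ∈ U' i → i = j := by
    intro v i hv hvi
    by_contra hi
    simp only [U', if_neg hi] at hvi
    exact hvi.2 hv
  have hfd : G.IsFocusedDecomposition (G.innerBoundary C) C (H \ M) U' N := by
    refine ⟨?_, ?_, ?_, ?_, ?_, ?_, ?_, ?_⟩
    · intro i v hv
      by_cases hvM : v ∈ M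
      · exact hvM.1.1
      · exact hU.bag_subset i ((hU'i v i hvM).1 hv)
    · exact Set.sdiff_subset.trans hU.subset
    · rintro v hv
      have hvH := hU.focus hv
      obtain ⟨⟨hvC, w, hw, hvw⟩, -⟩ := hv
      refine ⟨hvH, fun hvM => hvM.2 ?_⟩
      exact hclosed w (hAsub (hA.mem_of_adj v hvC w hw hvw)) v hvM.1.2 hvw.symm
    · intro v hv
      by_cases hvM : v ∈ M
      · exact ⟨j, hU'j ▸ Or.inr hvM⟩
      · obtain ⟨i, hi⟩ := hU.cover v hv
        exact ⟨i, (hU'i v i hvM).2 hi⟩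
    · intro u hu v hv huv
      by_cases huM : u ∈ M
      · exact ⟨j, hU'j ▸ Or.inr huM, hU'j ▸ hMU u huM v hv huv⟩
      · by_cases hvM : v ∈ M
        · exact ⟨j, hU'j ▸ hMU v hvM u hu huv.symm, hU'j ▸ Or.inr hvM⟩
        · obtain ⟨i, hi, hi'⟩ := hU.edge u hu v hv huv
          exact ⟨i, (hU'i u i huM).2 hi, (hU'i v i hvM).2 hi'⟩
    · intro v i k l hik hkl hi hl
      by_cases hvM : v ∈ M
      · have h1 := hU'M v i hvM hi
        have h2 := hU'M v l hvM hl
        obtain rfl : k = i := by omega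
        exact hi
      · rw [hU'i v _ hvM] at hi hl ⊢
        exact hU.consecutive v i k l hik hkl hi hl
    · intro v hv i k hi hk
      by_cases hvM : v ∈ M
      · rw [hU'M v i hvM hi, hU'M v k hvM hk]
      · rw [hU'i v _ hvM] at hi hk
        exact hU.unique v (fun h => hv ⟨h, hvM⟩) i k hi hk
    · intro i
      refine (Set.ncard_le_ncard ?_ (Set.toFinite _)).trans (hU.width i)
      rintro v ⟨hv, hvH, hvM⟩
      exact ⟨(hU'i v i hvM).1 hv, hvH⟩
  exact (hmin ⟨U', hfd⟩ Set.sdiff_subset hwH).2 ⟨⟨hwC, hw⟩, hwT⟩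

end Hubs

/-! ### Assembling the layered decomposition. -/

section Layered

variable {V W : Type*} {G : SimpleGraph V} {N : ℕ}

/-- A path decomposition of `G[C]` with bags `U 0, …, U (m - 1)` and a layering `ℓ` of `G[C]`, such
that each bag has at most `N` vertices in each layer and the inner boundary of `C` lies in layer
`0`. -/
structure IsLayeredDecomposition (G : SimpleGraph V) (N : ℕ) (C : Set V) (U : ℕ → Set V) (m : ℕ)
    (ℓ : V → ℕ) : Prop where
  bag_subset : ∀ j, U j ⊆ C
  cover : ∀ v ∈ C, ∃ j < m, v ∈ U j
  edge : ∀ u ∈ C, ∀ v ∈ C, G.Adj u v → ∃ j < m, u ∈ U j ∧ v ∈ U j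
  consecutive : ∀ v i j k, i ≤ j → j ≤ k → v ∈ U i → v ∈ U k → v ∈ U j
  width : ∀ j i, (U j ∩ {v | ℓ v = i}).ncard ≤ N
  layer : ∀ u ∈ C, ∀ v ∈ C, G.Adj u v → ℓ u ≤ ℓ v + 1
  boundary : ∀ v ∈ G.innerBoundary C, ℓ v = 0

/-- Layered decompositions of the parts of the bags outside `H` combine to a layered decomposition
with layer `0` equal to `H`. -/
theorem IsFocusedDecomposition.exists_isLayeredDecomposition [Finite V] {C H : Set V}
    {U : ℕ → Set V} (hU : G.IsFocusedDecomposition (G.innerBoundary C) C H U N)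
    (hD : ∀ j, ∃ U' m ℓ, G.IsLayeredDecomposition N (U j \ H) U' m ℓ) :
    ∃ U' m ℓ, G.IsLayeredDecomposition N C U' m ℓ := by
  classical
  choose R r ρ hR using hD
  choose! c hc using hU.cover
  choose! e he using hU.edge
  obtain ⟨m₁, hm₁⟩ := (Set.finite_range c).bddAbove
  obtain ⟨m₂, hm₂⟩ := (Set.finite_range fun p : V × V => e p.1 p.2).bddAbove
  have hcm : ∀ v, c v < m₁ + m₂ + 1 := fun v => by
    have := hm₁ ⟨v, rfl⟩
    omega
  have hem : ∀ u v, e u v < m₁ + m₂ + 1 := fun u v => by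
    have : e u v ≤ m₂ := hm₂ ⟨(u, v), rfl⟩
    omega
  set m := m₁ + m₂ + 1 with hm
  -- Each `U j` becomes a block of `K` bags, with index `j * K + k`. Taking `K` positive keeps `U j
  -- ∩ H` present even when `U j \ H` is empty.
  obtain ⟨K, hK0, hK⟩ : ∃ K, 0 < K ∧ ∀ j < m, r j ≤ K :=
    ⟨(Finset.range m).sup r + 1, by omega, fun j hj =>
      (Finset.le_sup (f := r) (Finset.mem_range.2 hj)).trans (Nat.le_succ _)⟩
  have hidx : ∀ j k, k < K → (j * K + k) / K = j ∧ (j * K + k) % K = k := fun j k hk =>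
    ⟨by rw [mul_comm, Nat.mul_add_div hK0, Nat.div_eq_of_lt hk, add_zero],
      by rw [mul_comm, Nat.mul_add_mod, Nat.mod_eq_of_lt hk]⟩
  have hlt : ∀ j k, j < m → k < K → j * K + k < m * K := fun j k hj hk => by
    calc j * K + k < j * K + K := by omega
      _ = (j + 1) * K := by ring
      _ ≤ m * K := Nat.mul_le_mul_right _ hj
  have hcj : ∀ v ∉ H, ∀ j, v ∈ U j → c v = j := fun v hv j hj =>
    hU.unique v hv _ _ (hc v (hU.bag_subset j hj)) hj
  let Q : ℕ → Set V := fun t => U (t / K) ∩ H ∪ R (t / K) (t % K)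
  have hQ : ∀ j k, k < K → Q (j * K + k) = U j ∩ H ∪ R j k := by
    intro j k hk
    simp only [Q, (hidx j k hk).1, (hidx j k hk).2]
  have hQU : ∀ t, Q t ⊆ U (t / K) := fun t => Set.union_subset Set.inter_subset_left
    (((hR _).bag_subset _).trans Set.sdiff_subset)
  have hQR : ∀ t, ∀ v ∈ Q t, v ∉ H → v ∈ R (t / K) (t % K) := by
    rintro t v (hv | hv) hvH
    · exact absurd hv.2 hvH
    · exact hv
  let ℓ : V → ℕ := fun v => if v ∈ H then 0 else ρ (c v) v + 1
  have hℓH : ∀ v ∈ H, ℓ v = 0 := fun v hv => if_pos hv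
  have hℓD : ∀ v ∉ H, ∀ j, v ∈ U j → ℓ v = ρ j v + 1 := fun v hv j hj => by
    simp only [ℓ, if_neg hv, hcj v hv j hj]
  -- A vertex outside `H` with a neighbour in `H` is in the inner boundary of its remainder, hence
  -- in layer 0 there.
  have hℓedge : ∀ u ∈ H, ∀ v ∉ H, u ∈ C → v ∈ C → G.Adj v u → ℓ v = 1 := by
    intro u hu v hv huC hvC hvu
    have hvj := hc v hvC
    rw [hℓD v hv _ hvj, (hR (c v)).boundary v ⟨⟨hvj, hv⟩, u, fun h => h.2 hu, hvu⟩]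
  refine ⟨Q, m * K, ℓ, ?_, ?_, ?_, ?_, ?_, ?_, ?_⟩
  · exact fun t => (hQU t).trans (hU.bag_subset _)
  · intro v hv
    by_cases hvH : v ∈ H
    · refine ⟨c v * K + 0, hlt _ _ (hcm v) hK0, ?_⟩
      rw [hQ _ _ hK0]
      exact Or.inl ⟨hc v hv, hvH⟩
    · obtain ⟨k, hk, hvk⟩ := (hR (c v)).cover v ⟨hc v hv, hvH⟩
      have hkK := hk.trans_le (hK _ (hcm v))
      refine ⟨c v * K + k, hlt _ _ (hcm v) hkK, ?_⟩
      rw [hQ _ _ hkK]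
      exact Or.inr hvk
  · intro u hu v hv huv
    obtain ⟨hue, hve⟩ := he u hu v hv huv
    have hj := hem u v
    set j := e u v
    have build : ∀ k, k < r j → (u ∈ H ∨ u ∈ R j k) → (v ∈ H ∨ v ∈ R j k) →
        ∃ t < m * K, u ∈ Q t ∧ v ∈ Q t := by
      intro k hk hu' hv'
      have hkK := hk.trans_le (hK _ hj)
      refine ⟨j * K + k, hlt _ _ hj hkK, ?_⟩
      rw [hQ _ _ hkK]
      exact ⟨hu'.imp (fun h => ⟨hue, h⟩) id, hv'.imp (fun h => ⟨hve, h⟩) id⟩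
    by_cases huH : u ∈ H <;> by_cases hvH : v ∈ H
    · refine ⟨j * K + 0, hlt _ _ hj hK0, ?_⟩
      rw [hQ _ _ hK0]
      exact ⟨Or.inl ⟨hue, huH⟩, Or.inl ⟨hve, hvH⟩⟩
    · obtain ⟨k, hk, hvk⟩ := (hR j).cover v ⟨hve, hvH⟩
      exact build k hk (Or.inl huH) (Or.inr hvk)
    · obtain ⟨k, hk, huk⟩ := (hR j).cover u ⟨hue, huH⟩
      exact build k hk (Or.inr huk) (Or.inl hvH)
    · obtain ⟨k, hk, huk, hvk⟩ := (hR j).edge u ⟨hue, huH⟩ v ⟨hve, hvH⟩ huv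
      exact build k hk (Or.inr huk) (Or.inr hvk)
  · intro v i j k hij hjk hi hk
    have h1 := Nat.div_le_div_right (c := K) hij
    have h2 := Nat.div_le_div_right (c := K) hjk
    by_cases hvH : v ∈ H
    · exact Or.inl ⟨hU.consecutive v _ _ _ h1 h2 (hQU i hi) (hQU k hk), hvH⟩
    · have h3 := hU.unique v hvH _ _ (hQU i hi) (hQU k hk)
      have h4 : j / K = i / K := by omega
      have hi' := hQR i v hi hvH
      have hk' := hQR k v hk hvH
      have e1 := Nat.div_add_mod i K
      have e2 := Nat.div_add_mod j K
      have e3 := Nat.div_add_mod k K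
      rw [h4] at e2
      rw [← h3] at e3 hk'
      refine Or.inr ?_
      rw [h4]
      exact (hR _).consecutive v _ _ _ (by omega) (by omega) hi' hk'
  -- Layer 0 of a bag lies in a single `U j ∩ H`, and each higher layer in one layer of a single bag
  -- of `R j`.
  · rintro t (_ | i)
    · refine (Set.ncard_le_ncard ?_ (Set.toFinite _)).trans (hU.width (t / K))
      rintro v ⟨hv, hv0⟩
      refine ⟨hQU t hv, ?_⟩
      by_contra hvH
      have h1 : ℓ v = 0 := hv0
      rw [hℓD v hvH _ (hQU t hv)] at h1
      omega
    · refine (Set.ncard_le_ncard ?_ (Set.toFinite _)).trans ((hR (t / K)).width (t % K) i)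
      rintro v ⟨hv, hvi⟩
      have h1 : ℓ v = i + 1 := hvi
      have hvH : v ∉ H := fun h => by
        rw [hℓH v h] at h1
        omega
      rw [hℓD v hvH _ (hQU t hv)] at h1
      exact ⟨hQR t v hv hvH, Nat.succ_injective h1⟩
  · intro u hu v hv huv
    by_cases huH : u ∈ H <;> by_cases hvH : v ∈ H
    · rw [hℓH u huH]; omega
    · rw [hℓH u huH]; omega
    · rw [hℓedge v hvH u huH hv hu huv]; omega
    · obtain ⟨hue, hve⟩ := he u hu v hv huv
      rw [hℓD u huH _ hue, hℓD v hvH _ hve]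
      have := (hR _).layer u ⟨hue, huH⟩ v ⟨hve, hvH⟩ huv
      omega
  · exact fun v hv => hℓH v (hU.focus ⟨hv, hv.1⟩)

/-- Sets that have a hub, or no neighbours at all, have layered decompositions in a graph without a
given apex-forest minor. -/
theorem exists_isLayeredDecomposition [Finite V] [Fintype W] {X : SimpleGraph W} {a : W}
    (hX : (X.induce {a}ᶜ).IsAcyclic) (hcard : 2 ≤ Fintype.card W) (hG : ¬ X.IsMinor G) (C : Set V)
    (hC : G.innerBoundary C = ∅ ∨ ∃ A, G.IsHub C A) :
    ∃ U m ℓ, G.IsLayeredDecomposition (2 * Fintype.card W - 3) C U m ℓ := by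
  classical
  have hne : Nonempty ({a}ᶜ : Set W) := by
    have : Nontrivial W := Fintype.one_lt_card_iff_nontrivial.1 hcard
    obtain ⟨b, hb⟩ := exists_ne a
    exact ⟨⟨b, hb⟩⟩
  obtain ⟨n, hn⟩ : ∃ n, C.ncard = n := ⟨_, rfl⟩
  induction n using Nat.strong_induction_on generalizing C with
  | _ n ih =>
  subst hn
  rcases C.eq_empty_or_nonempty with rfl | ⟨v, hv⟩
  · refine ⟨fun _ => ∅, 0, fun _ => 0, ?_, ?_, ?_, ?_, ?_, ?_, ?_⟩ <;> simp [innerBoundary]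
  by_cases hbd : G.innerBoundary C = ∅
  -- Without boundary there need be no hub: the single bag `C` with `H = {v}` makes `{v}` a hub of
  -- `C \ {v}`. The width 1 is allowed since `|W| ≥ 2`.
  · have hU : G.IsFocusedDecomposition (G.innerBoundary C) C {v}
        (fun j => if j = 0 then C else ∅) (2 * Fintype.card W - 3) := by
      refine ⟨?_, ?_, ?_, ?_, ?_, ?_, ?_, ?_⟩
      · intro j
        split_ifs <;> simp
      · simpa using hv
      · simp [hbd]
      · exact fun u hu => ⟨0, by simpa using hu⟩
      · exact fun u hu w hw _ => ⟨0, by simpa using hu, by simpa using hw⟩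
      · intro u i j k hij hjk hi hk
        have hk0 : k = 0 := by
          by_contra h
          simp [h] at hk
        obtain rfl : j = k := by omega
        exact hk
      · intro u _ i j hi hj
        have h1 : i = 0 := by
          by_contra h
          simp [h] at hi
        have h2 : j = 0 := by
          by_contra h
          simp [h] at hj
        rw [h1, h2]
      · intro j
        refine (Set.ncard_le_ncard Set.inter_subset_right (Set.toFinite _)).trans ?_
        rw [Set.ncard_singleton]
        omega
    refine hU.exists_isLayeredDecomposition fun j => ?_
    have hsub : (if j = 0 then C else ∅) \ {v} ⊆ C := Set.sdiff_subset.trans (hU.bag_subset j)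
    refine ih _ (Set.ncard_lt_ncard ⟨hsub, fun h => (h hv).2 rfl⟩ (Set.toFinite _)) _
      (Or.inr ⟨{v}, connected_induce_singleton v, ?_, ?_⟩) rfl
    · exact Set.disjoint_singleton_left.2 fun h => h.2 rfl
    · intro u hu w hw huw
      have hwC : w ∈ C := by
        by_contra hwC
        exact Set.notMem_empty u (hbd ▸ ⟨hsub hu, w, hwC, huw⟩)
      by_contra hwv
      refine hw ⟨?_, hwv⟩
      have hj : j = 0 := by
        by_contra h
        simp [h] at hu
      simpa [hj] using hwC
  · obtain ⟨A, hA⟩ := hC.resolve_left hbd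
    obtain ⟨H, U, hU, hhub⟩ := hA.exists_isFocusedDecomposition_forall_isHub
      (hA.exists_isFocusedDecomposition hX hG)
    -- A boundary vertex lies in `H`, so every remainder is smaller than `C`.
    obtain ⟨s, hs⟩ := Set.nonempty_iff_ne_empty.2 hbd
    refine hU.exists_isLayeredDecomposition fun j => ?_
    refine ih _ (Set.ncard_lt_ncard ⟨Set.sdiff_subset.trans (hU.bag_subset j), fun h => ?_⟩
      (Set.toFinite _)) _ (Or.inr (hhub j)) rfl
    exact (h hs.1).2 (hU.focus ⟨hs, hs.1⟩)

theorem IsLayeredDecomposition.layeredPathwidth_le [Finite V] {U : ℕ → Set V} {m : ℕ} {ℓ : V → ℕ}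
    (h : G.IsLayeredDecomposition N Set.univ U m ℓ) : G.layeredPathwidth ≤ N := by
  let B : PathDecomposition G :=
    -- One spare bag, because `m` may be 0 when `V` is empty; the width bound holds for every index.
    { length := m + 1
      length_pos := Nat.succ_pos m
      bag := fun i => U i
      edge_mem := fun u v huv => by
        obtain ⟨j, hj, hu, hv⟩ := h.edge u trivial v trivial huv
        exact ⟨⟨j, hj.trans (Nat.lt_succ_self m)⟩, hu, hv⟩
      vertex_mem := fun v => by
        obtain ⟨j, hj, hv⟩ := h.cover v trivial
        exact ⟨⟨j, hj.trans (Nat.lt_succ_self m)⟩, hv⟩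
      consecutive := fun v i j k hij hjk hi hk => h.consecutive v i j k hij hjk hi hk }
  let L : Layering G :=
    { layer := fun i => {v | ℓ v = i}
      disjoint := fun i j hij => Set.disjoint_left.2 fun v hi hj => hij (hi.symm.trans hj)
      cover := Set.eq_univ_of_forall fun v => Set.mem_iUnion.2 ⟨ℓ v, rfl⟩
      edge_mem := fun u v huv => by
        have h1 := h.layer u trivial v trivial huv
        have h2 := h.layer v trivial u trivial huv.symm
        refine ⟨min (ℓ u) (ℓ v), ?_, ?_⟩ <;> simp only [Set.mem_union, Set.mem_ofPred_eq] <;> omega }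
  refine (iInf₂_le B L).trans (iSup₂_le fun i j => ?_)
  rw [← Set.Finite.cast_ncard_eq (Set.toFinite _)]
  exact_mod_cast h.width i j

theorem IsApexForest.exists_isAcyclic_induce_compl_singleton [Nonempty W] {X : SimpleGraph W}
    (hX : X.IsApexForest) : ∃ a, (X.induce {a}ᶜ).IsAcyclic := by
  obtain ⟨s, hs, hac⟩ := hX
  obtain ⟨a, ha⟩ : ∃ a, s ⊆ {a} := by
    rcases s.eq_empty_or_nonempty with rfl | ⟨a, ha⟩
    · exact ⟨Classical.arbitrary W, Set.empty_subset _⟩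
    · exact ⟨a, fun b hb => hs hb ha⟩
  exact ⟨a, hac.embedding (induceHomOfLE X (Set.compl_subset_compl.2 ha))⟩

end Layered

end SimpleGraph

theorem theorem1 {W V : Type*} [Fintype W] [Finite V]
    (X : SimpleGraph W) (hX : X.IsApexForest) (hcard : 2 ≤ Fintype.card W)
    (G : SimpleGraph V) (hG : ¬ X.IsMinor G) :
    G.layeredPathwidth ≤ ((2 * Fintype.card W - 3 : ℕ) : ℕ∞) := by
  have : Nonempty W := Fintype.card_pos_iff.1 (by omega)
  obtain ⟨a, ha⟩ := hX.exists_isAcyclic_induce_compl_singleton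
  obtain ⟨U, m, ℓ, h⟩ := SimpleGraph.exists_isLayeredDecomposition ha hcard hG Set.univ
    (Or.inl (by simp [SimpleGraph.innerBoundary]))
  exact h.layeredPathwidth_le
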